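/- A set system $(V,\mathcal B)$ consists of a finite set $V$ of points and a family $\mathcal B$ of subsets of $V$, called blocks. It is an $S(2,k,v)$ (Steiner $2$-design) if $|V|=v$, every block has exactly $k$ points, and any two distinct points lie together in exactly one block. It is $r$-even-free if there is no set of $i$ blocks with $1\le i\le r$ such that every point lies in an even number (possibly zero) of these $i$ blocks. A set system with point set $\mathbb Z/v\mathbb Z$ is cyclic if $B+1$ is a block for every block $B$. A Singer cycle of $\mathrm{PG}(m,q)$ is a projectivity (a permutation of the points induced by an invertible linear map of $\mathbb F_q^{m+1}$) that permutes all the points in a single cycle. **Proposition.** Let $m\ge 3$ be an integer and $q$ an odd prime power, and put $v=\frac{q^{m+1}-1}{q-1}$. Then there exists a cyclic $(2q+1)$-even-free $S(2,q+1,v)$ with point set $\mathbb Z/v\mathbb Z$. Moreover, it can be chosen isomorphic to the set system of points and lines of $\mathrm{PG}(m,q)$, by a bijection from $\mathbb Z/v\mathbb Z$ to the points that carries the blocks exactly to the lines and the shift $i\mapsto i+1$ to a Singer cycle. -/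

import Mathlib

open scoped LinearAlgebra.Projectivization

/-- A set system whose point set is the type `V`, given by its family of blocks. Finiteness of the
point set is required where it is used, see `SetSystem.IsSteiner`. -/
structure SetSystem (V : Type*) where
  /-- The family of blocks. -/
  blocks : Set (Set V)

namespace SetSystem

/-- The set system is a Steiner 2-design `S(2,k,v)`: there are `v` points (finitely many), each
block has exactly `k` points, and any two distinct points lie together in exactly one block. -/
structure IsSteiner {V : Type*} (S : SetSystem V) (k v : ℕ) : Prop where
  finite : Finite V
  card_points : Nat.card V = v
  card_block : ∀ B ∈ S.blocks, B.ncard = k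
  existsUnique_block : ∀ a b : V, a ≠ b → ∃! B : Set V, B ∈ S.blocks ∧ a ∈ B ∧ b ∈ B

/-- `(W, C)` is an even configuration of the set system `S`: it is a set system with points and
blocks taken from `S`, and each point of `W` lies in an even number of the blocks in `C`. -/
structure IsEvenConfiguration {V : Type*} (S : SetSystem V) (W : Set V) (C : Set (Set V)) :
    Prop where
  subset_blocks : C ⊆ S.blocks
  block_subset : ∀ B ∈ C, B ⊆ W
  even : ∀ a ∈ W, Even {B | B ∈ C ∧ a ∈ B}.ncard

/-- `S` is `r`-even-free: for no positive `i ≤ r` does it contain an even configuration that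
consists of exactly `i` blocks. -/
def IsEvenFree {V : Type*} (S : SetSystem V) (r : ℕ) : Prop :=
  ∀ i : ℕ, 0 < i → i ≤ r →
    ¬ ∃ (W : Set V) (C : Set (Set V)), S.IsEvenConfiguration W C ∧ C.ncard = i

/-- A set system on the point set `ℤ/vℤ` is cyclic: the shift `B + 1` of any block `B` is again
a block. -/
def IsCyclic {v : ℕ} (S : SetSystem (ZMod v)) : Prop :=
  ∀ B ∈ S.blocks, (fun x : ZMod v => x + 1) '' B ∈ S.blocks

/-- The bijection `e` is an isomorphism of set systems: the images of the blocks of `S` are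
exactly the blocks of `T`. -/
def IsIso {V W : Type*} (S : SetSystem V) (T : SetSystem W) (e : V ≃ W) : Prop :=
  {L : Set W | ∃ B ∈ S.blocks, e '' B = L} = T.blocks

end SetSystem

/-- The set system of points and lines of the projective geometry `PG(m, F)`. Points are the
one-dimensional subspaces of `F ^ (m + 1)`; a line is the set of all points contained in a fixed
two-dimensional subspace. -/
def projectiveGeometry (F : Type*) [Field F] (m : ℕ) : SetSystem (ℙ F (Fin (m + 1) → F)) where
  blocks := {L | ∃ M : Submodule F (Fin (m + 1) → F),
    Module.finrank F M = 2 ∧ L = {p | p.submodule ≤ M}}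

/-- An invertible linear map of `F ^ (m + 1)` induces a Singer cycle of `PG(m, F)`: it permutes all
the points in a single cycle. -/
def IsSingerCycle {F : Type*} [Field F] {m : ℕ}
    (g : LinearMap.GeneralLinearGroup F (Fin (m + 1) → F)) : Prop :=
  (MulAction.toPerm g : Equiv.Perm (ℙ F (Fin (m + 1) → F))).IsCycleOn Set.univ

/-!
Let `q` be odd, let `C` be a nonempty family of lines of a projective space of order `q` such that
every point lies on an even number of them, and let `P` be the plane spanned by two intersecting
members of `C`. If all of `C` lies in `P`, counting incidences along each line of `P` modulo 2 shows
that `C` contains every line of `P`, so it has more than `q² + q` members. Otherwise let `n ≥ 2`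
members lie in `P` and `y > 0` not. The at least `n (q + 2 - n)` points on exactly one member inside
`P` need separate members outside, and a member outside needs `q` further ones to cover its points
off `P`, so `y ≥ q + 1`; together these bounds give `n + y ≥ 2q + 2`.

For cyclicity, `F ^ (m + 1)` is identified with the extension field `K` of degree `m + 1`: the
points are the powers `ζ ^ i` of a generator `ζ` of `Kˣ` up to factors in `Fˣ`, and multiplication
by `ζ` is the shift.
-/

namespace SetSystem

open Finset

variable {V : Type*} {S : SetSystem V} {P : Set V} {k q v : ℕ}

/-- A subspace of a set system is a set of points that contains every block with at least two
points in it. -/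
def IsSubspace (S : SetSystem V) (P : Set V) : Prop :=
  ∀ D ∈ S.blocks, (D ∩ P).Nontrivial → D ⊆ P

/-- A plane of a set system is a subspace in which any two blocks meet. Degenerate planes, with at
most one block, are allowed. -/
structure IsPlane (S : SetSystem V) (P : Set V) : Prop where
  isSubspace : S.IsSubspace P
  inter_nonempty : ∀ D ∈ S.blocks, D ⊆ P → ∀ E ∈ S.blocks, E ⊆ P → (D ∩ E).Nonempty

/-- Veblen–Young in the form used here: two blocks that meet lie in a common plane. -/
def HasPlanes (S : SetSystem V) : Prop :=
  ∀ A ∈ S.blocks, ∀ B ∈ S.blocks, (A ∩ B).Nonempty → ∃ P, S.IsPlane P ∧ A ⊆ P ∧ B ⊆ P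

theorem IsSteiner.isSubspace_block (hS : S.IsSteiner k v) {B : Set V} (hB : B ∈ S.blocks) :
    S.IsSubspace B := by
  rintro D hD ⟨a, ⟨haD, haB⟩, b, ⟨hbD, hbB⟩, hab⟩
  exact ((hS.existsUnique_block a b hab).unique ⟨hD, haD, hbD⟩ ⟨hB, haB, hbB⟩).subset

theorem IsSteiner.eq_of_subset (hS : S.IsSteiner k v) {A B : Set V} (hA : A ∈ S.blocks)
    (hB : B ∈ S.blocks) (hAB : A ⊆ B) : A = B :=
  have := hS.finite
  Set.eq_of_subset_of_ncard_le hAB (by rw [hS.card_block A hA, hS.card_block B hB])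

/-- Each block not contained in a subspace covers at most one of its points. -/
theorem IsSubspace.card_le_card_of_cover (hP : S.IsSubspace P) {T : Finset V}
    {Y : Finset (Set V)} (hT : ∀ a ∈ T, a ∈ P) (hY : ∀ D ∈ Y, D ∈ S.blocks ∧ ¬ D ⊆ P)
    (hcover : ∀ a ∈ T, ∃ D ∈ Y, a ∈ D) : #T ≤ #Y := by
  refine card_le_card_of_forall_subsingleton (fun a D => a ∈ D) hcover ?_
  rintro D hD a ⟨haT, haD⟩ b ⟨hbT, hbD⟩
  by_contra hab
  exact (hY D hD).2 (hP D (hY D hD).1 ⟨a, ⟨haD, hT a haT⟩, b, ⟨hbD, hT b hbT⟩, hab⟩)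

theorem IsSteiner.card_le_card_of_cover (hS : S.IsSteiner k v) {B : Set V} (hB : B ∈ S.blocks)
    {T : Finset V} {Y : Finset (Set V)} (hT : ∀ a ∈ T, a ∈ B)
    (hY : ∀ D ∈ Y, D ∈ S.blocks ∧ D ≠ B) (hcover : ∀ a ∈ T, ∃ D ∈ Y, a ∈ D) : #T ≤ #Y :=
  (hS.isSubspace_block hB).card_le_card_of_cover hT
    (fun D hD => ⟨(hY D hD).1, fun h => (hY D hD).2 (hS.eq_of_subset (hY D hD).1 hB h)⟩) hcover

open scoped Classical in
/-- An even family of blocks: every point lies in an even number of them. These are the block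
sets of even configurations, as finsets and without mention of the point set. -/
structure IsEvenFamily (S : SetSystem V) (C : Finset (Set V)) : Prop where
  mem_blocks : ∀ B ∈ C, B ∈ S.blocks
  even : ∀ a, Even #{B ∈ C | a ∈ B}

theorem IsEvenFamily.exists_ne {C : Finset (Set V)} (hC : S.IsEvenFamily C) {B : Set V}
    (hB : B ∈ C) {a : V} (ha : a ∈ B) : ∃ D ∈ C, D ≠ B ∧ a ∈ D := by
  classical
  have hBa : B ∈ ({B ∈ C | a ∈ B} : Finset (Set V)) := mem_filter.2 ⟨hB, ha⟩
  have hone : 1 < #{B ∈ C | a ∈ B} := by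
    obtain ⟨r, hr⟩ := hC.even a
    have := card_pos.2 ⟨B, hBa⟩
    omega
  obtain ⟨D, hD, hne⟩ := exists_mem_ne hone B
  exact ⟨D, (mem_filter.1 hD).1, hne, (mem_filter.1 hD).2⟩

theorem IsEvenConfiguration.isEvenFamily {C : Set (Set V)} (h : S.IsEvenConfiguration P C)
    (hC : C.Finite) : S.IsEvenFamily hC.toFinset where
  mem_blocks B hB := h.subset_blocks (hC.mem_toFinset.1 hB)
  even a := by
    classical
    by_cases ha : a ∈ P
    · convert h.even a ha
      rw [← Set.ncard_coe_finset]
      simp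
    · rw [filter_false_of_mem fun B hB haB => ha (h.block_subset B (hC.mem_toFinset.1 hB) haB)]
      simp

section Counting

open scoped Classical

variable {C X : Finset (Set V)} {B D : Set V}

theorem IsSteiner.card_toFinset [Fintype V] (hS : S.IsSteiner k v) (hB : B ∈ S.blocks) :
    #B.toFinset = k := by
  rw [← hS.card_block B hB, Set.ncard_eq_toFinset_card']

/-- The points of `B` that lie on no other member of the family `X`. -/
noncomputable def exclusivePoints [Fintype V] (X : Finset (Set V)) (B : Set V) : Finset V :=
  {a ∈ B.toFinset | ∀ D ∈ X, a ∈ D → D = B}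

theorem mem_exclusivePoints [Fintype V] {a : V} :
    a ∈ exclusivePoints X B ↔ a ∈ B ∧ ∀ D ∈ X, a ∈ D → D = B := by
  simp [exclusivePoints]

theorem IsSteiner.succ_le_card_add_card_exclusivePoints [Fintype V] (hS : S.IsSteiner k v)
    (hX : ∀ B ∈ X, B ∈ S.blocks) (hB : B ∈ X) : k + 1 ≤ #X + #(exclusivePoints X B) := by
  have hshared : #{a ∈ B.toFinset | ¬ ∀ D ∈ X, a ∈ D → D = B} ≤ #(X.erase B) := by
    refine hS.card_le_card_of_cover (hX B hB)
      (fun a ha => Set.mem_toFinset.1 (mem_filter.1 ha).1)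
      (fun D hD => ⟨hX D (mem_of_mem_erase hD), ne_of_mem_erase hD⟩) fun a ha => ?_
    obtain ⟨D, hDX, haD, hDB⟩ : ∃ D ∈ X, a ∈ D ∧ D ≠ B := by
      simpa only [not_forall, exists_prop] using (mem_filter.1 ha).2
    exact ⟨D, mem_erase.2 ⟨hDB, hDX⟩, haD⟩
  have hsplit : #(exclusivePoints X B) + #{a ∈ B.toFinset | ¬ ∀ D ∈ X, a ∈ D → D = B} = k := by
    rw [exclusivePoints, card_filter_add_card_filter_not, hS.card_toFinset (hX B hB)]
  have := card_erase_add_one hB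
  omega

/-- An exclusive point of a block inside `P` needs a second block, which leaves `P`, and two such
points need different ones. -/
theorem IsEvenFamily.sum_card_exclusivePoints_le [Fintype V] (hC : S.IsEvenFamily C)
    (hP : S.IsSubspace P) :
    ∑ B ∈ C with B ⊆ P, #(exclusivePoints {B ∈ C | B ⊆ P} B) ≤ #{B ∈ C | ¬ B ⊆ P} := by
  set X : Finset (Set V) := {B ∈ C | B ⊆ P}
  have hdisj : (X : Set (Set V)).PairwiseDisjoint (exclusivePoints X) := by
    intro A hA B _ hAB
    refine Finset.disjoint_left.2 fun a haA haB => hAB ?_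
    exact (mem_exclusivePoints.1 haB).2 A hA (mem_exclusivePoints.1 haA).1
  rw [← card_biUnion hdisj]
  refine hP.card_le_card_of_cover (fun a ha => ?_)
    (fun D hD => ⟨hC.mem_blocks D (mem_filter.1 hD).1, (mem_filter.1 hD).2⟩) fun a ha => ?_
  all_goals
    obtain ⟨B, hB, haB⟩ := mem_biUnion.1 ha
    obtain ⟨haB, honly⟩ := mem_exclusivePoints.1 haB
    obtain ⟨hBC, hBP⟩ := mem_filter.1 hB
  · exact hBP haB
  · obtain ⟨D, hDC, hDB, haD⟩ := hC.exists_ne hBC haB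
    exact ⟨D, mem_filter.2 ⟨hDC, fun hDP => hDB (honly D (mem_filter.2 ⟨hDC, hDP⟩) haD)⟩, haD⟩

theorem IsSteiner.card_mul_le_sq_add_card_outside (hS : S.IsSteiner k v)
    (hC : S.IsEvenFamily C) (hP : S.IsSubspace P) :
    #{B ∈ C | B ⊆ P} * (k + 1) ≤ #{B ∈ C | B ⊆ P} ^ 2 + #{B ∈ C | ¬ B ⊆ P} := by
  have := hS.finite
  have := Fintype.ofFinite V
  set X : Finset (Set V) := {B ∈ C | B ⊆ P}
  have hX : ∀ B ∈ X, B ∈ S.blocks := fun B hB => hC.mem_blocks B (mem_filter.1 hB).1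
  calc #X * (k + 1) = ∑ _B ∈ X, (k + 1) := by rw [sum_const, smul_eq_mul]
    _ ≤ ∑ B ∈ X, (#X + #(exclusivePoints X B)) :=
      sum_le_sum fun B hB => hS.succ_le_card_add_card_exclusivePoints hX hB
    _ = #X ^ 2 + ∑ B ∈ X, #(exclusivePoints X B) := by
      rw [sum_add_distrib, sum_const, smul_eq_mul, sq]
    _ ≤ #X ^ 2 + #{B ∈ C | ¬ B ⊆ P} := by grw [hC.sum_card_exclusivePoints_le hP]

/-- All points but one of a block that leaves `P` lie outside `P`, and each of them needs a second
block, which again leaves `P`. -/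
theorem IsSteiner.le_card_outside (hS : S.IsSteiner k v) (hC : S.IsEvenFamily C)
    (hP : S.IsSubspace P) (hB : B ∈ C) (hBP : ¬ B ⊆ P) : k ≤ #{B ∈ C | ¬ B ⊆ P} := by
  have := hS.finite
  have := Fintype.ofFinite V
  set Y : Finset (Set V) := {B ∈ C | ¬ B ⊆ P}
  have hBS := hC.mem_blocks B hB
  have hinside : #{a ∈ B.toFinset | a ∈ P} ≤ 1 := by
    rw [card_le_one_iff_subsingleton, ← Set.not_nontrivial_iff]
    exact fun h => hBP (hP B hBS (by convert h using 1; ext; simp))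
  have houtside : #{a ∈ B.toFinset | a ∉ P} ≤ #(Y.erase B) := by
    refine hS.card_le_card_of_cover hBS (fun a ha => Set.mem_toFinset.1 (mem_filter.1 ha).1)
      (fun D hD => ⟨hC.mem_blocks D (mem_filter.1 (mem_of_mem_erase hD)).1, ne_of_mem_erase hD⟩)
      fun a ha => ?_
    obtain ⟨haB, haP⟩ := mem_filter.1 ha
    obtain ⟨D, hDC, hDB, haD⟩ := hC.exists_ne hB (Set.mem_toFinset.1 haB)
    exact ⟨D, mem_erase.2 ⟨hDB, mem_filter.2 ⟨hDC, fun hDP => haP (hDP haD)⟩⟩, haD⟩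
  have hsplit := card_filter_add_card_filter_not (s := B.toFinset) (· ∈ P)
  rw [hS.card_toFinset hBS] at hsplit
  have hBY : B ∈ Y := mem_filter.2 ⟨hB, hBP⟩
  have := card_erase_add_one hBY
  omega

theorem IsSteiner.card_filter_mem_eq_one [Fintype V] (hS : S.IsSteiner k v) (hB : B ∈ S.blocks)
    (hD : D ∈ S.blocks) (hBD : B ≠ D) (hmeet : (D ∩ B).Nonempty) :
    #{a ∈ D.toFinset | a ∈ B} = 1 := by
  refine le_antisymm ?_ (card_pos.2 ?_)
  · rw [card_le_one_iff_subsingleton, ← Set.not_nontrivial_iff]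
    exact fun h => hBD.symm (hS.eq_of_subset hD hB
      (hS.isSubspace_block hB D hD (by convert h using 1; ext; simp)))
  · obtain ⟨a, haD, haB⟩ := hmeet
    exact ⟨a, mem_filter.2 ⟨Set.mem_toFinset.2 haD, haB⟩⟩

theorem IsSteiner.sum_card_filter_mem [Fintype V] (hS : S.IsSteiner (q + 1) v)
    (hC : ∀ B ∈ C, B ∈ S.blocks) (hD : D ∈ S.blocks) (hmeet : ∀ B ∈ C, (D ∩ B).Nonempty) :
    ∑ a ∈ D.toFinset, #{B ∈ C | a ∈ B} = #C + if D ∈ C then q else 0 := by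
  have hinter : ∀ B ∈ C, #{a ∈ D.toFinset | a ∈ B} = 1 + if D = B then q else 0 := by
    intro B hB
    split_ifs with h
    · subst h
      rw [filter_true_of_mem fun a ha => Set.mem_toFinset.1 ha, hS.card_toFinset hD, add_comm]
    · exact hS.card_filter_mem_eq_one (hC B hB) hD (Ne.symm h) (hmeet B hB)
  calc ∑ a ∈ D.toFinset, #{B ∈ C | a ∈ B} = ∑ B ∈ C, #{a ∈ D.toFinset | a ∈ B} :=
      sum_card_bipartiteAbove_eq_sum_card_bipartiteBelow (fun a B => a ∈ B)
    _ = ∑ B ∈ C, (1 + if D = B then q else 0) := sum_congr rfl hinter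
    _ = #C + if D ∈ C then q else 0 := by
      rw [sum_add_distrib, sum_ite_eq, sum_const, smul_eq_mul, mul_one]

/-- The incidence sums over the points of `D` and of a member of `C` are both even and differ by
`q` if `D` is missing from `C`. -/
theorem IsSteiner.mem_of_subset_plane (hS : S.IsSteiner (q + 1) v) (hq : Odd q)
    (hC : S.IsEvenFamily C) (hP : S.IsPlane P) (hCP : ∀ B ∈ C, B ⊆ P) (hne : C.Nonempty)
    (hD : D ∈ S.blocks) (hDP : D ⊆ P) : D ∈ C := by
  have := hS.finite
  have := Fintype.ofFinite V
  have hsum : ∀ D ∈ S.blocks, D ⊆ P → Even (#C + if D ∈ C then q else 0) := fun D hD hDP => by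
    rw [← hS.sum_card_filter_mem hC.mem_blocks hD fun B hB =>
      hP.inter_nonempty D hD hDP B (hC.mem_blocks B hB) (hCP B hB)]
    exact even_sum _ fun a _ => hC.even a
  by_contra hDC
  obtain ⟨A, hA⟩ := hne
  have hevenD := hsum D hD hDP
  have hevenA := hsum A (hC.mem_blocks A hA) (hCP A hA)
  rw [if_neg hDC, add_zero] at hevenD
  rw [if_pos hA] at hevenA
  exact Nat.not_even_iff_odd.2 hq ((Nat.even_add.1 hevenA).1 hevenD)

/-- Joining `a` to the points of `D` gives as many blocks through `a`. -/
theorem IsSteiner.le_card_filter_mem (hS : S.IsSteiner k v) (hP : S.IsSubspace P)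
    (hC : ∀ B ∈ S.blocks, B ⊆ P → B ∈ C) (hCS : ∀ B ∈ C, B ∈ S.blocks) (hD : D ∈ S.blocks)
    (hDP : D ⊆ P) {a : V} (haP : a ∈ P) (haD : a ∉ D) : k ≤ #{B ∈ C | a ∈ B} := by
  have := hS.finite
  have := Fintype.ofFinite V
  rw [← hS.card_toFinset hD]
  refine hS.card_le_card_of_cover hD (fun b hb => Set.mem_toFinset.1 hb) (fun B hB => ?_)
    fun b hb => ?_
  · obtain ⟨hBC, haB⟩ := mem_filter.1 hB
    exact ⟨hCS B hBC, fun h => haD (h ▸ haB)⟩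
  · rw [Set.mem_toFinset] at hb
    have hab : a ≠ b := fun h => haD (h ▸ hb)
    obtain ⟨B, hB, haB, hbB⟩ := (hS.existsUnique_block a b hab).exists
    exact ⟨B, mem_filter.2 ⟨hC B hB (hP B hB ⟨a, ⟨haB, haP⟩, b, ⟨hbB, hDP hb⟩, hab⟩), haB⟩, hbB⟩

theorem IsSteiner.lt_card_of_subset_plane (hS : S.IsSteiner (q + 1) v) (hq : Odd q)
    (hC : S.IsEvenFamily C) (hP : S.IsPlane P) (hCP : ∀ B ∈ C, B ⊆ P) (hne : C.Nonempty) :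
    q ^ 2 + q < #C := by
  have := hS.finite
  have := Fintype.ofFinite V
  obtain ⟨A, hA⟩ := hne
  have hAS := hC.mem_blocks A hA
  have hdegree : ∀ a ∈ A.toFinset, q + 1 ≤ #{B ∈ C | a ∈ B} := by
    intro a ha
    obtain ⟨b, hb, hba⟩ := exists_mem_ne (by have := hq.pos; rw [hS.card_toFinset hAS]; omega) a
    rw [Set.mem_toFinset] at ha hb
    obtain ⟨D, hD, hDA, hbD⟩ := hC.exists_ne hA hb
    have hDS := hC.mem_blocks D hD
    have haD : a ∉ D := fun haD => hDA (hS.eq_of_subset hDS hAS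
      (hS.isSubspace_block hAS D hDS ⟨b, ⟨hbD, hb⟩, a, ⟨haD, ha⟩, hba⟩))
    exact hS.le_card_filter_mem hP.isSubspace
      (fun B hB hBP => hS.mem_of_subset_plane hq hC hP hCP ⟨A, hA⟩ hB hBP) hC.mem_blocks hDS
      (hCP D hD) (hCP A hA ha) haD
  have hcount : (q + 1) * (q + 1) ≤ #C + q := by
    calc (q + 1) * (q + 1) = ∑ _a ∈ A.toFinset, (q + 1) := by
          rw [sum_const, hS.card_toFinset hAS, smul_eq_mul]
      _ ≤ ∑ a ∈ A.toFinset, #{B ∈ C | a ∈ B} := sum_le_sum hdegree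
      _ = #C + q := by
        rw [hS.sum_card_filter_mem hC.mem_blocks hAS fun B hB =>
          hP.inter_nonempty A hAS (hCP A hA) B (hC.mem_blocks B hB) (hCP B hB), if_pos hA]
  linarith

theorem IsSteiner.lt_card_of_isEvenFamily (hS : S.IsSteiner (q + 1) v) (hq : Odd q) (hq1 : 1 < q)
    (hplanes : S.HasPlanes) (hC : S.IsEvenFamily C) (hne : C.Nonempty) : 2 * q + 1 < #C := by
  have := hS.finite
  have := Fintype.ofFinite V
  obtain ⟨A, hA⟩ := hne
  have hAS := hC.mem_blocks A hA
  obtain ⟨a, ha⟩ : A.Nonempty := by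
    rw [← Set.toFinset_nonempty, ← card_pos, hS.card_toFinset hAS]
    exact q.succ_pos
  obtain ⟨B, hB, hBA, haB⟩ := hC.exists_ne hA ha
  obtain ⟨P, hP, hAP, hBP⟩ := hplanes A hAS B (hC.mem_blocks B hB) ⟨a, ha, haB⟩
  by_cases hCP : ∀ B ∈ C, B ⊆ P
  · have := hS.lt_card_of_subset_plane hq hC hP hCP ⟨A, hA⟩
    nlinarith
  · push Not at hCP
    obtain ⟨L, hL, hLP⟩ := hCP
    have houtside := hS.le_card_outside hC hP.isSubspace hL hLP
    have hexclusive := hS.card_mul_le_sq_add_card_outside hC hP.isSubspace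
    have hinside : 1 < #{B ∈ C | B ⊆ P} := one_lt_card.2
      ⟨A, mem_filter.2 ⟨hA, hAP⟩, B, mem_filter.2 ⟨hB, hBP⟩, hBA.symm⟩
    have hsplit := card_filter_add_card_filter_not (s := C) (· ⊆ P)
    -- `n` blocks inside and `y` outside with `y ≥ q + 1`, `y ≥ n (q + 2 - n)`: if `n + y ≤ 2q + 1`,
    -- then `2 ≤ n ≤ q` and `(n - 2) (q + 1 - n) ≥ 0` gives a contradiction.
    by_contra! hle
    nlinarith [mul_le_mul hinside (show #{B ∈ C | B ⊆ P} ≤ q by omega) (by omega) (by omega)]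

end Counting

theorem IsSteiner.isEvenFree (hS : S.IsSteiner (q + 1) v) (hq : Odd q) (hq1 : 1 < q)
    (hplanes : S.HasPlanes) : S.IsEvenFree (2 * q + 1) := by
  have := hS.finite
  rintro i hi hle ⟨W, C, hWC, rfl⟩
  have hfin : C.Finite := C.toFinite
  have hlt := hS.lt_card_of_isEvenFamily hq hq1 hplanes (hWC.isEvenFamily hfin)
    (hfin.toFinset_nonempty.2 (Set.nonempty_of_ncard_ne_zero hi.ne'))
  rw [← Set.ncard_eq_toFinset_card C hfin] at hlt
  omega

end SetSystem

section Projective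

open Module Projectivization

variable {F V W : Type*} [Field F] [AddCommGroup V] [Module F V] [AddCommGroup W]
  [Module F W]

variable (F V) in
/-- The set system of points and lines of the projective space `ℙ F V`, for a vector space without
a preferred basis. -/
def projectiveSpace : SetSystem (ℙ F V) where
  blocks := {L | ∃ M : Submodule F V, finrank F M = 2 ∧ L = M.projectivization}

theorem projectiveSpace_eq_projectiveGeometry (F : Type*) [Field F] (m : ℕ) :
    projectiveSpace F (Fin (m + 1) → F) = projectiveGeometry F m := by
  have hcoe (M : Submodule F (Fin (m + 1) → F)) :
      (M.projectivization : Set (ℙ F (Fin (m + 1) → F))) = {p | p.submodule ≤ M} :=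
    Set.ext fun p => M.mem_projectivization_iff_submodule_le p
  simp only [projectiveSpace, projectiveGeometry, hcoe]

theorem coe_projectivization_subset {M N : Submodule F V} :
    (M.projectivization : Set (ℙ F V)) ⊆ N.projectivization ↔ M ≤ N :=
  Submodule.projectivization.le_iff_le

theorem coe_projectivization_eq_range (M : Submodule F V) :
    (M.projectivization : Set (ℙ F V)) = Set.range (map M.subtype M.subtype_injective) := by
  ext p
  constructor
  · induction p using ind with | h x hx =>
    exact fun hxM => ⟨mk F ⟨x, hxM⟩ fun h => hx (congrArg Subtype.val h), rfl⟩
  · rintro ⟨y, rfl⟩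
    induction y using ind with | h y _ =>
    exact y.2

theorem ncard_projectivization (M : Submodule F V) :
    (M.projectivization : Set (ℙ F V)).ncard = Nat.card (ℙ F M) := by
  rw [coe_projectivization_eq_range, ← Nat.card_coe_set_eq,
    Nat.card_range_of_injective (map_injective _ _)]

theorem exists_line_le {U : Submodule F V} {p r : ℙ F V} (hp : p ∈ U.projectivization)
    (hr : r ∈ U.projectivization) (h : p ≠ r) :
    ∃ M ≤ U, finrank F M = 2 ∧ p ∈ M.projectivization ∧ r ∈ M.projectivization := by
  simp only [Submodule.mem_projectivization_iff_submodule_le, submodule_eq,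
    Submodule.span_singleton_le_iff_mem] at hp hr ⊢
  refine ⟨Submodule.span F (Set.range ![p.rep, r.rep]), ?_, ?_, Submodule.subset_span ⟨0, rfl⟩,
    Submodule.subset_span ⟨1, rfl⟩⟩
  · simp [Submodule.span_le, Set.pair_subset_iff, hp, hr]
  · simpa using finrank_span_eq_card (linearIndependent_pair_iff_ne.2 h)

theorem projectiveSpace_isSteiner [Finite F] [Finite V] :
    (projectiveSpace F V).IsSteiner (Nat.card F + 1) (Nat.card (ℙ F V)) where
  finite := inferInstance
  card_points := rfl
  card_block := by
    rintro _ ⟨M, hM, rfl⟩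
    rw [ncard_projectivization, card_of_finrank_two F M hM]
  existsUnique_block p r h := by
    have mem_top (s : ℙ F V) : s ∈ (⊤ : Submodule F V).projectivization :=
      (Submodule.mem_projectivization_iff_submodule_le _ _).2 le_top
    obtain ⟨M, -, hM, hpM, hrM⟩ := exists_line_le (U := ⊤) (mem_top p) (mem_top r) h
    refine ⟨_, ⟨⟨M, hM, rfl⟩, hpM, hrM⟩, ?_⟩
    rintro _ ⟨⟨N, hN, rfl⟩, hpN, hrN⟩
    rw [line_unique h M N hM hN hpM hrM hpN hrN]

theorem projectiveSpace_isSubspace (U : Submodule F V) :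
    (projectiveSpace F V).IsSubspace U.projectivization := by
  rintro _ ⟨M, hM, rfl⟩ ⟨p, ⟨hpM, hpU⟩, r, ⟨hrM, hrU⟩, hne⟩
  obtain ⟨N, hNU, hN, hpN, hrN⟩ := exists_line_le hpU hrU hne
  rw [line_unique hne M N hM hN hpM hrM hpN hrN]
  exact coe_projectivization_subset.2 hNU

theorem inf_ne_bot_of_finrank_lt {M N U : Submodule F V} [FiniteDimensional F U] (hMU : M ≤ U)
    (hNU : N ≤ U) (h : finrank F U < finrank F M + finrank F N) : M ⊓ N ≠ ⊥ := by
  have := Submodule.finiteDimensional_of_le hMU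
  have := Submodule.finiteDimensional_of_le hNU
  have hsum := Submodule.finrank_sup_add_finrank_inf_eq M N
  have hsup := Submodule.finrank_mono (sup_le hMU hNU)
  intro hbot
  rw [hbot, finrank_bot] at hsum
  omega

theorem projectiveSpace_isPlane {U : Submodule F V} [FiniteDimensional F U]
    (hU : finrank F U ≤ 3) : (projectiveSpace F V).IsPlane U.projectivization where
  isSubspace := projectiveSpace_isSubspace U
  inter_nonempty := by
    rintro _ ⟨M, hM, rfl⟩ hMU _ ⟨N, hN, rfl⟩ hNU
    have hMN : M ⊓ N ≠ ⊥ := inf_ne_bot_of_finrank_lt (coe_projectivization_subset.1 hMU)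
      (coe_projectivization_subset.1 hNU) (by omega)
    obtain ⟨x, ⟨hxM, hxN⟩, hx⟩ := Submodule.exists_mem_ne_zero_of_ne_bot hMN
    exact ⟨mk F x hx, hxM, hxN⟩

theorem projectiveSpace_hasPlanes : (projectiveSpace F V).HasPlanes := by
  rintro _ ⟨M, hM, rfl⟩ _ ⟨N, hN, rfl⟩ ⟨p, hpM, hpN⟩
  have := Module.finite_of_finrank_eq_succ hM
  have := Module.finite_of_finrank_eq_succ hN
  have hsum := Submodule.finrank_sup_add_finrank_inf_eq M N
  have hinf : 1 ≤ finrank F ↥(M ⊓ N) := by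
    rw [← finrank_submodule p]
    exact Submodule.finrank_mono (le_inf ((M.mem_projectivization_iff_submodule_le p).1 hpM)
      ((N.mem_projectivization_iff_submodule_le p).1 hpN))
  exact ⟨(M ⊔ N).projectivization, projectiveSpace_isPlane (by omega),
    coe_projectivization_subset.2 le_sup_left, coe_projectivization_subset.2 le_sup_right⟩

/-- The bijection of projective spaces induced by a linear equivalence. -/
def projectiveCongr (b : V ≃ₗ[F] W) : ℙ F V ≃ ℙ F W where
  toFun := map b.toLinearMap b.injective
  invFun := map b.symm.toLinearMap b.symm.injective
  left_inv p := by induction p using ind with | h x hx => simp [map_mk]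
  right_inv p := by induction p using ind with | h x hx => simp [map_mk]

theorem projectiveCongr_mk (b : V ≃ₗ[F] W) {x : V} (hx : x ≠ 0) :
    projectiveCongr b (mk F x hx) = mk F (b x) (b.map_ne_zero_iff.2 hx) :=
  rfl

theorem image_projectiveCongr (b : V ≃ₗ[F] W) (M : Submodule F V) :
    projectiveCongr b '' M.projectivization = (M.map b.toLinearMap).projectivization := by
  ext p
  obtain ⟨p, rfl⟩ := (projectiveCongr b).surjective p
  rw [(projectiveCongr b).injective.mem_set_image]
  induction p using ind with | h x hx =>
  simp [projectiveCongr_mk]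

theorem projectiveSpace_isIso (b : V ≃ₗ[F] W) :
    (projectiveSpace F V).IsIso (projectiveSpace F W) (projectiveCongr b) := by
  ext L
  constructor
  · rintro ⟨_, ⟨M, hM, rfl⟩, rfl⟩
    exact ⟨_, by rw [LinearEquiv.finrank_map_eq, hM], image_projectiveCongr b M⟩
  · rintro ⟨M, hM, rfl⟩
    refine ⟨_, ⟨M.map b.symm.toLinearMap, by rw [LinearEquiv.finrank_map_eq, hM], rfl⟩, ?_⟩
    rw [image_projectiveCongr, ← Submodule.map_comp]
    simp

end Projective

namespace SetSystem

variable {V W X : Type*} {S : SetSystem V} {T : SetSystem W} {R : SetSystem X} {e : V ≃ W}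

theorem isIso_iff : S.IsIso T e ↔ ∀ B, e '' B ∈ T.blocks ↔ B ∈ S.blocks := by
  constructor
  · rintro h B
    rw [← h]
    constructor
    · rintro ⟨A, hA, hAB⟩
      rwa [← e.injective.image_injective hAB]
    · exact fun hB => ⟨B, hB, rfl⟩
  · intro h
    ext L
    constructor
    · rintro ⟨B, hB, rfl⟩
      exact (h B).2 hB
    · exact fun hL => ⟨e ⁻¹' L, (h _).1 (by rwa [e.image_preimage]), e.image_preimage L⟩

theorem IsIso.trans {f : W ≃ X} (h : S.IsIso T e) (h' : T.IsIso R f) : S.IsIso R (e.trans f) := by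
  rw [isIso_iff] at *
  intro B
  rw [Equiv.coe_trans, Set.image_comp, h', h]

theorem IsIso.isSteiner (h : S.IsIso T e) {k v : ℕ} (hT : T.IsSteiner k v) :
    S.IsSteiner k v where
  finite := have := hT.finite; Finite.of_equiv W e.symm
  card_points := by rw [Nat.card_congr e, hT.card_points]
  card_block B hB := by
    rw [← hT.card_block _ ((isIso_iff.1 h B).2 hB), Set.ncard_image_of_injective _ e.injective]
  existsUnique_block a b hab := by
    obtain ⟨B, ⟨hB, ha, hb⟩, huniq⟩ := hT.existsUnique_block (e a) (e b) (e.injective.ne hab)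
    refine ⟨e ⁻¹' B, ⟨(isIso_iff.1 h _).1 (by rwa [e.image_preimage]), ha, hb⟩, ?_⟩
    rintro A ⟨hA, haA, hbA⟩
    rw [← huniq (e '' A) ⟨(isIso_iff.1 h A).2 hA, Set.mem_image_of_mem e haA,
      Set.mem_image_of_mem e hbA⟩, e.preimage_image]

theorem IsEvenConfiguration.image {P : Set V} {C : Set (Set V)} (hPC : S.IsEvenConfiguration P C)
    (h : S.IsIso T e) : T.IsEvenConfiguration (e '' P) ((e '' ·) '' C) where
  subset_blocks := by
    rintro _ ⟨B, hB, rfl⟩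
    exact (isIso_iff.1 h B).2 (hPC.subset_blocks hB)
  block_subset := by
    rintro _ ⟨B, hB, rfl⟩
    exact Set.image_mono (hPC.block_subset B hB)
  even := by
    rintro _ ⟨a, ha, rfl⟩
    have himage : {B | B ∈ (e '' ·) '' C ∧ e a ∈ B} = (e '' ·) '' {B | B ∈ C ∧ a ∈ B} := by
      ext L
      constructor
      · rintro ⟨⟨B, hB, rfl⟩, haB⟩
        exact ⟨B, ⟨hB, e.injective.mem_set_image.1 haB⟩, rfl⟩
      · rintro ⟨B, ⟨hB, haB⟩, rfl⟩
        exact ⟨⟨B, hB, rfl⟩, Set.mem_image_of_mem e haB⟩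
    rw [himage, Set.ncard_image_of_injective _ e.injective.image_injective]
    exact hPC.even a ha

theorem IsIso.isEvenFree (h : S.IsIso T e) {r : ℕ} (hT : T.IsEvenFree r) : S.IsEvenFree r := by
  rintro i hi hle ⟨P, C, hPC, hcard⟩
  refine hT i hi hle ⟨e '' P, (e '' ·) '' C, hPC.image h, ?_⟩
  rw [Set.ncard_image_of_injective _ e.injective.image_injective, hcard]

theorem IsIso.isCyclic {v : ℕ} {S : SetSystem (ZMod v)} {e : ZMod v ≃ W} (h : S.IsIso T e)
    {f : Equiv.Perm W} (hf : T.IsIso T f) (he : ∀ i, e (i + 1) = f (e i)) : S.IsCyclic := by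
  intro B hB
  have himage : e '' ((fun i => i + 1) '' B) = f '' (e '' B) := by simp only [Set.image_image, he]
  rw [← isIso_iff.1 h, himage, isIso_iff.1 hf, isIso_iff.1 h]
  exact hB

end SetSystem

section SingleCycle

variable {α β G : Type*}

theorem isCycleOn_toPerm_of_generator [Group G] [MulAction G α] [MulAction.IsPretransitive G α]
    {ζ : G} (hζ : ∀ x, x ∈ Subgroup.zpowers ζ) :
    (MulAction.toPerm ζ : Equiv.Perm α).IsCycleOn Set.univ := by
  refine ⟨Set.bijOn_univ.2 (MulAction.bijective ζ), fun a _ b _ => ?_⟩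
  obtain ⟨x, rfl⟩ := MulAction.exists_smul_eq G a b
  obtain ⟨n, rfl⟩ := hζ x
  exact ⟨n, by rw [← MulAction.toPermHom_apply, ← map_zpow]; rfl⟩

theorem isCycleOn_univ_of_semiconj {f : Equiv.Perm α} {g : Equiv.Perm β} (φ : α ≃ β)
    (h : Function.Semiconj φ f g) (hf : f.IsCycleOn Set.univ) : g.IsCycleOn Set.univ := by
  refine ⟨Set.bijOn_univ.2 g.bijective, fun x _ y _ => ?_⟩
  obtain ⟨n, hn⟩ := hf.2 (Set.mem_univ (φ.symm x)) (Set.mem_univ (φ.symm y))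
  obtain rfl : g = φ.permCongrHom f := Equiv.ext fun x => by
    simpa using (h (φ.symm x)).symm
  exact ⟨n, by rw [← map_zpow]; simp [hn]⟩

theorem exists_zmodEquiv_of_isCycleOn [Finite α] {f : Equiv.Perm α} (hf : f.IsCycleOn Set.univ)
    (a : α) : ∃ e : ZMod (Nat.card α) ≃ α, ∀ n : ℕ, e n = (f ^ n) a := by
  have := Fintype.ofFinite α
  have : NeZero (Nat.card α) := ⟨(Nat.card_pos_iff.2 ⟨⟨a⟩, inferInstance⟩).ne'⟩
  rw [← Finset.coe_univ] at hf
  have hval (n : ℕ) : (f ^ (n : ZMod (Nat.card α)).val) a = (f ^ n) a := by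
    rw [hf.pow_apply_eq_pow_apply (Finset.mem_univ a), Finset.card_univ,
      ← Nat.card_eq_fintype_card, ← ZMod.natCast_eq_natCast_iff, ZMod.natCast_zmod_val]
  have hsurj : Function.Surjective fun i : ZMod (Nat.card α) => (f ^ i.val) a := fun b => by
    obtain ⟨n, -, hn⟩ := hf.exists_pow_eq (Finset.mem_univ a) (Finset.mem_univ b)
    exact ⟨n, (hval n).trans hn⟩
  exact ⟨Equiv.ofBijective _ (hsurj.bijective_of_nat_card_le (Nat.card_zmod _).le), hval⟩

end SingleCycle

section Singer

open Module Projectivization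

variable {F K E V : Type*} [Field F] [Field K] [Algebra F K] [Field E] [AddCommGroup V]
  [Module F V]

instance isPretransitive_units_projectivization : MulAction.IsPretransitive Kˣ (ℙ F K) where
  exists_smul_eq p r := by
    induction p using ind with | h x hx =>
    induction r using ind with | h y hy =>
    refine ⟨Units.mk0 y hy / Units.mk0 x hx, ?_⟩
    simp [Units.smul_def, hx]

variable (F) in
/-- The lines of the projective space `ℙ F K` of a field extension, where `i : ZMod v` stands for
the point spanned by `ζ ^ i`. It is meant for `v ≠ 0` with `ζ ^ v` in `F`, when the choice of the
representative `i.val` of `i` does not matter. -/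
def singerSystem (ζ : K) (v : ℕ) : SetSystem (ZMod v) where
  blocks := {B | ∃ M : Submodule F K, finrank F M = 2 ∧ B = {i | ζ ^ i.val ∈ M}}

theorem singerSystem_isIso {ζ : K} {v : ℕ} (hζ : ζ ≠ 0) {e : ZMod v ≃ ℙ F K}
    (he : ∀ i, e i = mk F (ζ ^ i.val) (pow_ne_zero _ hζ)) :
    (singerSystem F ζ v).IsIso (projectiveSpace F K) e := by
  have hblock (M : Submodule F K) : e '' {i | ζ ^ i.val ∈ M} = M.projectivization := by
    ext p
    obtain ⟨i, rfl⟩ := e.surjective p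
    rw [e.injective.mem_set_image, he]
    rfl
  ext L
  constructor
  · rintro ⟨_, ⟨M, hM, rfl⟩, rfl⟩
    exact ⟨M, hM, hblock M⟩
  · rintro ⟨M, hM, rfl⟩
    exact ⟨_, ⟨M, hM, rfl⟩, hblock M⟩

variable (F) in
theorem projectiveSpace_isIso_toPerm (u : Kˣ) :
    (projectiveSpace F K).IsIso (projectiveSpace F K) (MulAction.toPerm u) := by
  have htoPerm : MulAction.toPerm u = projectiveCongr (DistribMulAction.toLinearEquiv F K u) := rfl
  exact htoPerm ▸ projectiveSpace_isIso _

theorem exists_singerSystem_isIso [Finite K] {ζ : Kˣ} (hζ : ∀ x, x ∈ Subgroup.zpowers ζ) {v : ℕ}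
    (hv : Nat.card (ℙ F K) = v) : ∃ e : ZMod v ≃ ℙ F K,
      (singerSystem F (ζ : K) v).IsIso (projectiveSpace F K) e ∧ ∀ i, e (i + 1) = ζ • e i := by
  subst hv
  have := Finite.of_injective _ (algebraMap F K).injective
  have : NeZero (Nat.card (ℙ F K)) := ⟨Nat.card_pos.ne'⟩
  obtain ⟨e, he⟩ := exists_zmodEquiv_of_isCycleOn
    (isCycleOn_toPerm_of_generator (α := ℙ F K) hζ) (mk F 1 one_ne_zero)
  have hpow (n : ℕ) : e n = ζ ^ n • mk F 1 one_ne_zero := by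
    rw [he, ← MulAction.toPermHom_apply, ← map_pow, MulAction.toPermHom_apply,
      MulAction.toPerm_apply]
  refine ⟨e, singerSystem_isIso ζ.ne_zero fun i => ?_, fun i => ?_⟩
  · rw [← ZMod.natCast_zmod_val i, hpow, smul_mk]
    simp [Units.smul_def]
  · obtain ⟨n, rfl⟩ := ZMod.natCast_zmod_surjective i
    rw [← Nat.cast_succ, hpow, hpow, pow_succ', mul_smul]

/-- Multiplication by `u` on `K`, read in the coordinates `b`. -/
def mulInCoordinates (b : K ≃ₗ[F] V) (u : Kˣ) : LinearMap.GeneralLinearGroup F V :=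
  .ofLinearEquiv (b.symm ≪≫ₗ DistribMulAction.toLinearEquiv F K u ≪≫ₗ b)

theorem projectiveCongr_smul (b : K ≃ₗ[F] V) (u : Kˣ) (p : ℙ F K) :
    projectiveCongr b (u • p) = mulInCoordinates b u • projectiveCongr b p := by
  induction p using ind with | h x hx =>
  rw [smul_mk, projectiveCongr_mk, projectiveCongr_mk, smul_mk]
  simp [mulInCoordinates]

theorem exists_singerCycle [Finite K] {m v : ℕ} (hK : finrank F K = m + 1) {ζ : Kˣ}
    (hζ : ∀ x, x ∈ Subgroup.zpowers ζ) (hv : Nat.card (ℙ F K) = v) :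
    ∃ (g : LinearMap.GeneralLinearGroup F (Fin (m + 1) → F))
      (e : ZMod v ≃ ℙ F (Fin (m + 1) → F)), IsSingerCycle g ∧
      (singerSystem F (ζ : K) v).IsIso (projectiveGeometry F m) e ∧
      ∀ i, e (i + 1) = g • e i := by
  obtain ⟨e, hiso, he⟩ := exists_singerSystem_isIso hζ hv
  let b : K ≃ₗ[F] (Fin (m + 1) → F) := LinearEquiv.ofFinrankEq _ _ (by simpa using hK)
  refine ⟨mulInCoordinates b ζ, e.trans (projectiveCongr b), ?_, ?_, fun i => ?_⟩
  · exact isCycleOn_univ_of_semiconj (f := MulAction.toPerm ζ) (projectiveCongr b)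
      (projectiveCongr_smul b ζ) (isCycleOn_toPerm_of_generator hζ)
  · rw [← projectiveSpace_eq_projectiveGeometry]
    exact hiso.trans (projectiveSpace_isIso b)
  · rw [Equiv.trans_apply, he, projectiveCongr_smul, Equiv.trans_apply]

theorem finrank_restrictScalars_of_bijective [Algebra F E] [Algebra E K] [IsScalarTower F E K]
    (h : Function.Bijective (algebraMap F E)) (M : Submodule E K) :
    finrank F (M.restrictScalars F) = finrank E M := by
  rw [← one_mul (finrank E M), ← Module.finrank_of_bijective_algebraMap h]
  exact (finrank_mul_finrank F E M).symm

theorem singerSystem_eq_of_bijective [Algebra F E] [Algebra E K] [IsScalarTower F E K]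
    (h : Function.Bijective (algebraMap F E)) (ζ : K) (v : ℕ) :
    singerSystem F ζ v = singerSystem E ζ v := by
  rw [singerSystem, singerSystem, SetSystem.mk.injEq]
  ext B
  constructor
  · rintro ⟨M, hM, rfl⟩
    let N : Submodule E K :=
      { M with
        smul_mem' c x hx := by
          obtain ⟨c, rfl⟩ := h.2 c
          rw [algebraMap_smul]
          exact M.smul_mem c hx }
    exact ⟨N, by rw [← finrank_restrictScalars_of_bijective h]; exact hM, rfl⟩
  · rintro ⟨M, hM, rfl⟩
    exact ⟨M.restrictScalars F, by rw [finrank_restrictScalars_of_bijective h, hM], rfl⟩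

theorem card_projectivization_eq [Finite F] {m : ℕ} (hK : finrank F K = m + 1) :
    Nat.card (ℙ F K) = (Nat.card F ^ (m + 1) - 1) / (Nat.card F - 1) := by
  have := Module.finite_of_finrank_eq_succ hK
  rw [card'', Module.natCard_eq_pow_finrank (K := F), hK]

theorem exists_singerCycle_of_ringEquiv [Finite K] (φ : E ≃+* F) {m v : ℕ}
    (hK : finrank F K = m + 1) {ζ : Kˣ} (hζ : ∀ x, x ∈ Subgroup.zpowers ζ)
    (hv : Nat.card (ℙ F K) = v) :
    ∃ (g : LinearMap.GeneralLinearGroup E (Fin (m + 1) → E))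
      (e : ZMod v ≃ ℙ E (Fin (m + 1) → E)), IsSingerCycle g ∧
      (singerSystem F (ζ : K) v).IsIso (projectiveGeometry E m) e ∧
      ∀ i, e (i + 1) = g • e i := by
  let : Algebra E F := φ.toRingHom.toAlgebra
  let : Algebra E K := ((algebraMap F K).comp φ.toRingHom).toAlgebra
  have : IsScalarTower E F K := .of_algebraMap_eq' rfl
  have hφ : Function.Bijective (algebraMap E F) := φ.bijective
  have : Finite F := Finite.of_injective _ (algebraMap F K).injective
  have : Finite E := Finite.of_equiv F φ.symm.toEquiv
  rw [← singerSystem_eq_of_bijective hφ]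
  refine exists_singerCycle ?_ hζ ?_
  · rw [← finrank_mul_finrank E F K, finrank_of_bijective_algebraMap hφ, hK, one_mul]
  · rw [← hv, card'', card'', Nat.card_congr φ.toEquiv]

end Singer

theorem proposition2p7_general (m q : ℕ) (hq : IsPrimePow q) (hodd : Odd q) :
    ∃ S : SetSystem (ZMod ((q ^ (m + 1) - 1) / (q - 1))),
      S.IsSteiner (q + 1) ((q ^ (m + 1) - 1) / (q - 1)) ∧
      S.IsEvenFree (2 * q + 1) ∧
      S.IsCyclic ∧
      ∀ (F : Type*) [Field F] [Finite F], Nat.card F = q →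
        ∃ (g : LinearMap.GeneralLinearGroup F (Fin (m + 1) → F))
          (e : ZMod ((q ^ (m + 1) - 1) / (q - 1)) ≃ ℙ F (Fin (m + 1) → F)),
          IsSingerCycle g ∧
          S.IsIso (projectiveGeometry F m) e ∧
          ∀ i : ZMod ((q ^ (m + 1) - 1) / (q - 1)), e (i + 1) = g • e i := by
  obtain ⟨p, n, hp, hn, rfl⟩ := (isPrimePow_nat_iff q).1 hq
  have : Fact p.Prime := ⟨hp⟩
  let F₀ := GaloisField p n
  let K := FiniteField.Extension F₀ p (m + 1)
  have hF₀ : Nat.card F₀ = p ^ n := GaloisField.card p n hn.ne'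
  have hK : Module.finrank F₀ K = m + 1 := FiniteField.finrank_extension F₀ p (m + 1)
  have hv : Nat.card (ℙ F₀ K) = ((p ^ n) ^ (m + 1) - 1) / (p ^ n - 1) := by
    rw [card_projectivization_eq hK, hF₀]
  obtain ⟨ζ, hζ⟩ := IsCyclic.exists_generator (α := Kˣ)
  obtain ⟨e, hiso, he⟩ := exists_singerSystem_isIso hζ hv
  have hsteiner := projectiveSpace_isSteiner (F := F₀) (V := K)
  rw [hF₀, hv] at hsteiner
  refine ⟨singerSystem F₀ (ζ : K) _, hiso.isSteiner hsteiner,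
    hiso.isEvenFree (hsteiner.isEvenFree hodd hq.one_lt projectiveSpace_hasPlanes),
    hiso.isCyclic (projectiveSpace_isIso_toPerm F₀ ζ) he, fun F _ _ hF => ?_⟩
  have := Fintype.ofFinite F
  have := Fintype.ofFinite F₀
  have hcard : Fintype.card F = Fintype.card F₀ := by
    simp only [← Nat.card_eq_fintype_card, hF, hF₀]
  exact exists_singerCycle_of_ringEquiv (FiniteField.ringEquivOfCardEq hcard) hK hζ hv

theorem proposition2p7 (m q : ℕ) (hm : 3 ≤ m) (hq : IsPrimePow q) (hodd : Odd q) :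
    ∃ S : SetSystem (ZMod ((q ^ (m + 1) - 1) / (q - 1))),
      S.IsSteiner (q + 1) ((q ^ (m + 1) - 1) / (q - 1)) ∧
      S.IsEvenFree (2 * q + 1) ∧
      S.IsCyclic ∧
      ∀ (F : Type*) [Field F] [Finite F], Nat.card F = q →
        ∃ (g : LinearMap.GeneralLinearGroup F (Fin (m + 1) → F))
          (e : ZMod ((q ^ (m + 1) - 1) / (q - 1)) ≃ ℙ F (Fin (m + 1) → F)),
          IsSingerCycle g ∧
          S.IsIso (projectiveGeometry F m) e ∧
          ∀ i : ZMod ((q ^ (m + 1) - 1) / (q - 1)), e (i + 1) = g • e i :=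
  proposition2p7_general m q hq hodd
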